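/- Let $X$ be the self-adjoint multiplication operator $(Xf)(x)=x f(x)$ on $L^2(\mathbb{R},\mathbb{C})$ with domain $\{f\in L^2(\mathbb{R},\mathbb{C}) : \int_{\mathbb{R}} x^2|f(x)|^2\,dx<\infty\}$, let $\Phi(x)=\pi^{-1/4}e^{-x^2/2}$, and for a self-adjoint operator $A$ write $\langle e^{itA}\rangle=\langle \Phi,e^{itA}\Phi\rangle$ for its characteristic function in the state $\Phi$, where $(e^{itA})_{t\in\mathbb{R}}$ is the unique strongly continuous one-parameter unitary group with infinitesimal generator $iA$. Let $T=\sqrt2\,X$ and $S=\sigma T$, where $\sigma>0$. Then $S$ is $\mathcal N(0,\sigma^2)$-distributed, i.e. $\langle e^{itS}\rangle=e^{-\sigma^2t^2/2}$ for all $t\in\mathbb{R}$, and the characteristic function of its cube $S^3$ (on its natural domain) is, for every $t\in\mathbb{R}$, $$\langle e^{itS^3}\rangle=\begin{cases}\dfrac{1}{3\sigma^3|t|\sqrt{6\pi}}\;e^{\frac{1}{108\sigma^6t^2}}\;K_{1/3}\!\left(\dfrac{1}{108\sigma^6t^2}\right), & t\neq 0,\\[2mm] 1, & t=0,\end{cases}$$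 where $K_\nu$ is the modified Bessel function of the second kind, $K_\nu(x)=\int_0^\infty e^{-x\cosh u}\cosh(\nu u)\,du$ for $x>0$. Likewise, if $Z$ is any real random variable on a probability space with law $\mathcal N(0,\sigma^2)$, then $\mathbb{E}\,e^{itZ^3}$ is given by the same formula for every $t\in\mathbb{R}$. -/

import Mathlib

open MeasureTheory ProbabilityTheory
open scoped ENNReal

noncomputable section

/-- The Hilbert space `L²(ℝ, ℂ)`; its inner product is conjugate-linear in the first variable. -/
abbrev HilbL2 : Type := Lp ℂ 2 (volume : Measure ℝ)

/-- The position operator `(X f)(x) = x f(x)`, with its maximal domain, the space of all `f ∈ L²`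
for which `x ↦ x f(x)` is square integrable. -/
def positionOp : HilbL2 →ₗ.[ℂ] HilbL2 where
  domain :=
    { carrier := {f | MemLp (fun x : ℝ => (x : ℂ) * f x) 2 volume}
      add_mem' := by
        intro f g hf hg
        refine (MemLp.add hf hg).ae_eq ?_
        filter_upwards [Lp.coeFn_add f g] with x hx
        rw [hx]
        exact (mul_add _ _ _).symm
      zero_mem' := by
        refine (MemLp.zero' (ε := ℂ)).ae_eq ?_
        filter_upwards [Lp.coeFn_zero ℂ 2 (volume : Measure ℝ)] with x hx
        rw [hx]
        exact (mul_zero _).symm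
      smul_mem' := by
        intro c f hf
        refine (MemLp.const_smul hf c).ae_eq ?_
        filter_upwards [Lp.coeFn_smul c f] with x hx
        simp [hx, mul_left_comm] }
  toFun :=
    { toFun := fun f => MemLp.toLp (fun x : ℝ => (x : ℂ) * (f : HilbL2) x) f.2
      map_add' := by
        intro f g
        rw [← MemLp.toLp_add]
        refine MemLp.toLp_congr _ _ ?_
        filter_upwards [Lp.coeFn_add (f : HilbL2) (g : HilbL2)] with x hx
        exact (congrArg ((x : ℂ) * ·) hx).trans (mul_add _ _ _)
      map_smul' := by
        intro c f
        rw [RingHom.id_apply, ← MemLp.toLp_const_smul]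
        refine MemLp.toLp_congr _ _ ?_
        filter_upwards [Lp.coeFn_smul c (f : HilbL2)] with x hx
        simp [hx, mul_left_comm] }

/-- The composition `B ∘ A` of two unbounded operators, on its natural domain, the space of all
`f ∈ dom A` with `A f ∈ dom B`. -/
def unboundedComp (B A : HilbL2 →ₗ.[ℂ] HilbL2) : HilbL2 →ₗ.[ℂ] HilbL2 where
  domain :=
    { carrier := {f | ∃ h : f ∈ A.domain, A ⟨f, h⟩ ∈ B.domain}
      add_mem' := by
        rintro f g ⟨hf, hf'⟩ ⟨hg, hg'⟩
        refine ⟨add_mem hf hg, ?_⟩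
        have h : A ⟨f + g, add_mem hf hg⟩ = A ⟨f, hf⟩ + A ⟨g, hg⟩ := A.map_add ⟨f, hf⟩ ⟨g, hg⟩
        rw [h]
        exact add_mem hf' hg'
      zero_mem' := by
        refine ⟨zero_mem _, ?_⟩
        have h : A ⟨0, zero_mem _⟩ = 0 := A.map_zero
        rw [h]
        exact zero_mem _
      smul_mem' := by
        rintro c f ⟨hf, hf'⟩
        refine ⟨Submodule.smul_mem _ c hf, ?_⟩
        have h : A ⟨c • f, Submodule.smul_mem _ c hf⟩ = c • A ⟨f, hf⟩ := A.map_smul c ⟨f, hf⟩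
        rw [h]
        exact Submodule.smul_mem _ c hf' }
  toFun :=
    { toFun := fun f => B ⟨A ⟨f, f.2.1⟩, f.2.2⟩
      map_add' := by
        intro f g
        rw [← B.map_add]
        congr 1
        exact Subtype.ext (A.map_add ⟨f, f.2.1⟩ ⟨g, g.2.1⟩)
      map_smul' := by
        intro c f
        rw [RingHom.id_apply, ← B.map_smul]
        congr 1
        exact Subtype.ext (A.map_smul c ⟨f, f.2.1⟩) }

/-- The cube `A³` of an unbounded operator, on its natural domain. -/
def unboundedCube (A : HilbL2 →ₗ.[ℂ] HilbL2) : HilbL2 →ₗ.[ℂ] HilbL2 :=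
  unboundedComp A (unboundedComp A A)

/-- The operator `T = √2 X`. -/
def opT : HilbL2 →ₗ.[ℂ] HilbL2 := ((√2 : ℝ) : ℂ) • positionOp

/-- The operator `S = σ T`. -/
def opS (σ : ℝ) : HilbL2 →ₗ.[ℂ] HilbL2 := (σ : ℂ) • opT

/-- `U t = exp (i t A)`: `U` is a strongly continuous one-parameter unitary group whose
infinitesimal generator is exactly `i A`, domain included (Stone's theorem). -/
structure IsUnitaryGroupOf (A : HilbL2 →ₗ.[ℂ] HilbL2) (U : ℝ → HilbL2 →L[ℂ] HilbL2) : Prop where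
  unitary : ∀ t, U t ∈ unitary (HilbL2 →L[ℂ] HilbL2)
  map_add : ∀ s t, U (s + t) = U s * U t
  continuous : ∀ f, Continuous fun t => U t f
  generator : ∀ f g, (f, g) ∈ A.graph ↔ HasDerivAt (fun t : ℝ => U t f) (Complex.I • g) 0

theorem memLp_gaussian :
    MemLp (fun x : ℝ => ((Real.pi ^ (-1 / 4 : ℝ) * Real.exp (-x ^ 2 / 2) : ℝ) : ℂ)) 2 volume := by
  apply MemLp.ofReal
  refine MemLp.const_mul ?_ _
  rw [memLp_two_iff_integrable_sq (by fun_prop)]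
  refine (integrable_exp_neg_mul_sq (b := 1) one_pos).congr ?_
  filter_upwards with x
  rw [← Real.exp_nat_mul]
  congr 1
  push_cast
  ring

/-- The state `Φ(x) = π^{-1/4} exp(-x²/2)`. -/
def gaussianState : HilbL2 := memLp_gaussian.toLp _

/-- `φ` is the characteristic function of the observable `A` in the state `Φ`: the unitary group
`exp (i t A)` exists and is unique, and `φ t = ⟨Φ, exp (i t A) Φ⟩` for all real `t`. -/
def HasQuantumCharFun (A : HilbL2 →ₗ.[ℂ] HilbL2) (φ : ℝ → ℂ) : Prop :=
  ∃ U, IsUnitaryGroupOf A U ∧ (∀ V, IsUnitaryGroupOf A V → V = U) ∧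
    ∀ t, φ t = inner ℂ gaussianState (U t gaussianState)

/-- The modified Bessel function of the second kind `K_ν(x)`, for real order `ν` and real argument
`x > 0`: `K_ν(x) = ∫₀^∞ exp(-x cosh u) cosh(ν u) du`. -/
def besselK (ν x : ℝ) : ℝ :=
  ∫ u in Set.Ioi (0 : ℝ), Real.exp (-x * Real.cosh u) * Real.cosh (ν * u)

/-- The closed form of the characteristic function of the cube of a centred Gaussian variable of
variance `σ²`. -/
def cubeCharFun (σ t : ℝ) : ℝ :=
  if t = 0 then 1
  else 1 / (3 * σ ^ 3 * |t| * √(6 * Real.pi)) * Real.exp (1 / (108 * σ ^ 6 * t ^ 2)) *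
    besselK (1 / 3) (1 / (108 * σ ^ 6 * t ^ 2))

end

/-!
The operator `S` is multiplication by `σ √2 x`, with its maximal domain, and the natural domain of
`S³` is the maximal domain of multiplication by `(σ √2 x)³` (`IsMultiplicationBy.cube`). A maximal
multiplication operator by a real function `m` generates the group of multiplications by
`exp (i t m)`: dominated convergence gives strong continuity and the derivative on the domain, and
almost everywhere convergence along a sequence identifies the domain of the generator
(`hasDerivAt_phaseMul_iff`). A group is determined by its generator because the squared distance
between two orbits with the same starting point in the (dense) domain has zero derivative
(`IsUnitaryGroupOf.unique`). Since `|Φ|²` is the density of `N(0, 1/2)`, the quantum characteristic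
functions are those of `N(0, σ²)` and of its image under the cube
(`inner_gaussianState_phaseMul`), and everything reduces to one integral.

With `s = t σ³ > 0`, that integral is `∫ exp (i s y³ - y² / 2) dy` over the real line. On the
hyperbola `y(v) = (√3 sinh v + i (cosh v - 1)) / (6 s)`, which passes through the saddle point `0`,
the exponent is `z - z cosh (3 v)` with `z = 1 / (108 s²)`
(`cubicGaussian_descentPath`), by the tripling formula for `cosh`. Between the hyperbola and the
real line the integrand is bounded by `exp (-x² / 3)`, where `x` is the real part, so the contour
can be moved (`integral_cubicGaussian`). The component of the velocity along `cosh v` gives the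
integral defining `K_{1/3}` after `u = 3 v`, and the one along `sinh v` integrates to zero by
parity. Negative `t` follow from `y ↦ -y`.
-/

open Filter Topology

/-! ### The cubic Gaussian integral and the Bessel function -/

/-- The entire function `w ↦ exp (i s w³ - w² / 2)`, whose integral over the real line is, up to
the factor `√(2π)`, the characteristic function at `s` of the cube of a standard Gaussian. -/
noncomputable def cubicGaussian (s : ℝ) (w : ℂ) : ℂ :=
  Complex.exp (Complex.I * s * w ^ 3 - w ^ 2 / 2)

/-- A parametrization of the branch through `0` of the steepest-descent hyperbola of
`cubicGaussian s`: its saddle point is `0`, and the exponent is real along it. -/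
noncomputable def descentPath (s v : ℝ) : ℂ :=
  ((1 / (3 * s) * (√3 / 2) * Real.sinh v : ℝ) : ℂ) +
    ((1 / (3 * s) * (1 / 2) * (Real.cosh v - 1) : ℝ) : ℂ) * Complex.I

lemma differentiable_cubicGaussian (s : ℝ) : Differentiable ℂ (cubicGaussian s) := by
  unfold cubicGaussian
  fun_prop

lemma cubicGaussian_descentPath {s : ℝ} (hs : 0 < s) (v : ℝ) :
    cubicGaussian s (descentPath s v) =
      ((Real.exp (1 / (108 * s ^ 2)) *
        Real.exp (-(1 / (108 * s ^ 2)) * Real.cosh (3 * v)) : ℝ) : ℂ) := by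
  rw [← Real.exp_add, Complex.ofReal_exp, cubicGaussian]
  congr 1
  have hS : ((Real.sinh v : ℝ) : ℂ) ^ 2 = (Real.cosh v : ℂ) ^ 2 - 1 := by
    have := Real.sinh_sq v
    exact_mod_cast this
  have hr : ((√3 : ℝ) : ℂ) ^ 2 = 3 := by
    have := Real.sq_sqrt (show (0 : ℝ) ≤ 3 by norm_num)
    exact_mod_cast this
  have hk : (s : ℂ) * (1 / (3 * s)) = 1 / 3 := by
    have : (s : ℂ) ≠ 0 := by exact_mod_cast hs.ne'
    field_simp
  have hz : 1 / (108 * (s : ℂ) ^ 2) = (1 / (3 * s)) ^ 2 / 12 := by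
    have : (s : ℂ) ≠ 0 := by exact_mod_cast hs.ne'
    field_simp
    norm_num
  rw [Real.cosh_three_mul]
  unfold descentPath
  push_cast
  rw [hz]
  push_cast at hS hr hk
  generalize Complex.sinh (v : ℂ) = S at *
  generalize Complex.cosh (v : ℂ) = C at *
  generalize ((√3 : ℝ) : ℂ) = r at *
  generalize 1 / (3 * (s : ℂ)) = k at *
  have hI := Complex.I_sq
  have h2 : (k * (r / 2) * S + k * (1 / 2) * (C - 1) * Complex.I) ^ 2 =
      k ^ 2 / 2 * (C - 1) * (C + 2 + Complex.I * r * S) := by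
    linear_combination k ^ 2 / 4 * (S ^ 2 * hr + 3 * hS + (C - 1) ^ 2 * hI)
  have h3 : (k * (r / 2) * S + k * (1 / 2) * (C - 1) * Complex.I) ^ 3 =
      k ^ 3 / 4 * (C - 1) * (3 * r * S + Complex.I * (C - 1) * (4 * C + 5)) := by
    rw [pow_succ, h2]
    linear_combination k ^ 3 / 4 * (C - 1) *
      (Complex.I * (S ^ 2 * hr + 3 * hS) + (C - 1) * r * S * hI)
  rw [h2, h3]
  linear_combination (k ^ 2 / 4 * (C - 1) * Complex.I *
    (3 * r * S + Complex.I * (C - 1) * (4 * C + 5))) * hk +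
    k ^ 2 / 12 * (C - 1) ^ 2 * (4 * C + 5) * hI

/-- The velocity of `descentPath`. -/
lemma hasDerivAt_descentPath (s v : ℝ) :
    HasDerivAt (descentPath s)
      (((1 / (3 * s) * (√3 / 2) * Real.cosh v : ℝ) : ℂ) +
        ((1 / (3 * s) * (1 / 2) * Real.sinh v : ℝ) : ℂ) * Complex.I) v := by
  unfold descentPath
  refine HasDerivAt.add ?_ (HasDerivAt.mul_const ?_ _)
  · exact ((Real.hasDerivAt_sinh v).const_mul _).ofReal_comp
  · exact (((Real.hasDerivAt_cosh v).sub_const 1).const_mul _).ofReal_comp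

/-- Between the real line and the descent path, `cubicGaussian` decays like a Gaussian. -/
lemma norm_cubicGaussian_le {s x b : ℝ} (hs : 0 < s) (hb : 0 ≤ b) (hbx : 3 * b ^ 2 ≤ x ^ 2) :
    ‖cubicGaussian s (x + b * Complex.I)‖ ≤ Real.exp (-x ^ 2 / 3) := by
  rw [cubicGaussian, Complex.norm_exp, Real.exp_le_exp]
  have : (Complex.I * s * (x + b * Complex.I) ^ 3 - (x + b * Complex.I) ^ 2 / 2 : ℂ) =
      ((s * b ^ 3 - 3 * s * x ^ 2 * b - x ^ 2 / 2 + b ^ 2 / 2 : ℝ) : ℂ) +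
        ((s * x ^ 3 - 3 * s * x * b ^ 2 - x * b : ℝ) : ℂ) * Complex.I := by
    have hI := Complex.I_sq
    have hI4 : Complex.I ^ 4 = 1 := Complex.I_pow_four
    push_cast
    linear_combination (3 * s * x ^ 2 * b - b ^ 2 / 2 + 3 * s * x * b ^ 2 * Complex.I) * hI +
      s * b ^ 3 * hI4
  rw [this]
  simp only [Complex.add_re, Complex.ofReal_re, Complex.re_ofReal_mul, Complex.I_re, mul_zero,
    add_zero]
  have h1 : s * b * b ^ 2 ≤ s * b * x ^ 2 := by
    exact mul_le_mul_of_nonneg_left (by nlinarith [sq_nonneg b]) (by positivity)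
  have h2 : 0 ≤ s * b * x ^ 2 := by positivity
  nlinarith

/-- Comparing a primitive of `cubicGaussian` at a point and at its projection to the real line. -/
lemma norm_primitive_sub_le {s : ℝ} (hs : 0 < s) {F : ℂ → ℂ}
    (hF : ∀ w, HasDerivAt F (cubicGaussian s w) w) {x b : ℝ} (hb : 0 ≤ b)
    (hbx : 3 * b ^ 2 ≤ x ^ 2) :
    ‖F (x + b * Complex.I) - F x‖ ≤ |x| * Real.exp (-x ^ 2 / 3) := by
  have key := norm_image_sub_le_of_norm_deriv_le_segment' (a := 0) (b := b)
    (f := fun t : ℝ => F (x + t * Complex.I))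
    (f' := fun t : ℝ => cubicGaussian s (x + t * Complex.I) * Complex.I)
    (C := Real.exp (-x ^ 2 / 3)) ?_ ?_ b ⟨hb, le_rfl⟩
  · have hbx' : b ≤ |x| := by
      apply le_of_sq_le_sq _ (abs_nonneg x)
      rw [sq_abs]
      nlinarith [sq_nonneg b]
    simp only [Complex.ofReal_zero, zero_mul, add_zero, sub_zero] at key
    refine key.trans ?_
    rw [mul_comm]
    gcongr
  · intro t _
    have h1 : HasDerivAt (fun t : ℝ => (x : ℂ) + t * Complex.I) Complex.I t := by
      simpa using ((hasDerivAt_id t).ofReal_comp.mul_const Complex.I).const_add (x : ℂ)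
    exact ((hF _).comp t h1).hasDerivWithinAt
  · intro t ht
    rw [norm_mul, Complex.norm_I, mul_one]
    refine norm_cubicGaussian_le hs ht.1 (le_trans ?_ hbx)
    have := ht.1
    have := ht.2
    gcongr

lemma integrable_cosh_mul_exp_neg_mul_sq {b : ℝ} (hb : 0 < b) :
    Integrable fun v : ℝ => Real.cosh v * Real.exp (-b * v ^ 2) := by
  have h (c : ℝ) : Integrable fun v : ℝ => Real.exp (-b * v ^ 2 + c * v) := by
    have := (integrable_cexp_quadratic (b := b) (by simpa using hb) c 0).norm
    refine this.congr (ae_of_all _ fun v => ?_)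
    simp only [Complex.norm_exp]
    congr 1
    norm_cast
    simp
  refine (((h 1).add (h (-1))).div_const 2).congr (ae_of_all _ fun v => ?_)
  simp only [Pi.add_apply, Real.exp_add, Real.cosh_eq, one_mul, neg_mul]
  ring

lemma integrable_exp_neg_cosh_mul_cosh {z : ℝ} (hz : 0 < z) :
    Integrable fun v : ℝ => Real.exp (-z * Real.cosh (3 * v)) * Real.cosh v := by
  refine (integrable_cosh_mul_exp_neg_mul_sq (b := 9 * z / 4) (by positivity)).mono'
    (by fun_prop) (ae_of_all _ fun v => ?_)
  rw [Real.norm_of_nonneg (by positivity), mul_comm]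
  refine mul_le_mul_of_nonneg_left (Real.exp_le_exp.2 ?_) (Real.cosh_pos v).le
  have h1 : (3 * v) ^ 2 / 4 ≤ Real.cosh (3 * v) := by
    rw [← Real.cosh_abs, ← sq_abs, Real.cosh_eq]
    have := Real.quadratic_le_exp_of_nonneg (abs_nonneg (3 * v))
    have := Real.exp_pos (-|3 * v|)
    have := abs_nonneg (3 * v)
    linarith
  nlinarith

lemma integrable_exp_neg_cosh_mul_sinh {z : ℝ} (hz : 0 < z) :
    Integrable fun v : ℝ => Real.exp (-z * Real.cosh (3 * v)) * Real.sinh v := by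
  refine (integrable_exp_neg_cosh_mul_cosh hz).mono' (by fun_prop) (ae_of_all _ fun v => ?_)
  rw [norm_mul, Real.norm_of_nonneg (Real.exp_nonneg _), Real.norm_eq_abs, Real.abs_sinh,
    ← Real.cosh_abs v]
  gcongr
  exact (Real.sinh_lt_cosh _).le

lemma integral_exp_neg_cosh_mul_sinh (z : ℝ) :
    ∫ v : ℝ, Real.exp (-z * Real.cosh (3 * v)) * Real.sinh v = 0 := by
  have := integral_neg_eq_self (fun v : ℝ => Real.exp (-z * Real.cosh (3 * v)) * Real.sinh v) volume
  simp only [mul_neg, Real.cosh_neg, Real.sinh_neg] at this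
  rw [integral_neg] at this
  linarith

lemma integral_exp_neg_cosh_mul_cosh (z : ℝ) :
    ∫ v : ℝ, Real.exp (-z * Real.cosh (3 * v)) * Real.cosh v = 2 / 3 * besselK (1 / 3) z := by
  have h1 := integral_comp_abs (f := fun v => Real.exp (-z * Real.cosh (3 * v)) * Real.cosh v)
  have h2 (v : ℝ) : Real.cosh (3 * |v|) = Real.cosh (3 * v) := by
    rw [← Real.cosh_abs (3 * v), abs_mul, abs_of_pos (show (0 : ℝ) < 3 by norm_num)]
  simp only [h2, Real.cosh_abs] at h1
  have h3 := integral_comp_mul_left_Ioi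
    (fun u => Real.exp (-z * Real.cosh u) * Real.cosh (1 / 3 * u)) 0 (show (0 : ℝ) < 3 by norm_num)
  have h4 (v : ℝ) : 1 / 3 * (3 * v) = v := by ring
  simp only [h4, mul_zero, smul_eq_mul] at h3
  rw [h1, h3, besselK]
  ring

/-- The integrand pulled back to the descent path. -/
lemma cubicGaussian_descentPath_mul_deriv {s : ℝ} (hs : 0 < s) (v : ℝ) :
    cubicGaussian s (descentPath s v) *
      (((1 / (3 * s) * (√3 / 2) * Real.cosh v : ℝ) : ℂ) +
        ((1 / (3 * s) * (1 / 2) * Real.sinh v : ℝ) : ℂ) * Complex.I) =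
    (Real.exp (1 / (108 * s ^ 2)) * (1 / (3 * s) * (√3 / 2)) : ℝ) *
      ((Real.exp (-(1 / (108 * s ^ 2)) * Real.cosh (3 * v)) * Real.cosh v : ℝ) : ℂ) +
    ((Real.exp (1 / (108 * s ^ 2)) * (1 / (3 * s) * (1 / 2)) : ℝ) * Complex.I) *
      ((Real.exp (-(1 / (108 * s ^ 2)) * Real.cosh (3 * v)) * Real.sinh v : ℝ) : ℂ) := by
  rw [cubicGaussian_descentPath hs]
  push_cast
  ring

lemma integrable_cubicGaussian (s : ℝ) : Integrable fun x : ℝ => cubicGaussian s x := by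
  refine (integrable_exp_neg_mul_sq (b := 1 / 2) (by norm_num)).mono'
    ((differentiable_cubicGaussian s).continuous.comp
      Complex.continuous_ofReal).aestronglyMeasurable (ae_of_all _ fun x => ?_)
  rw [cubicGaussian, Complex.norm_exp]
  have : (Complex.I * s * x ^ 3 - x ^ 2 / 2 : ℂ) =
      ((-(1 / 2) * x ^ 2 : ℝ) : ℂ) + ((s * x ^ 3 : ℝ) : ℂ) * Complex.I := by
    push_cast
    ring
  rw [this, Complex.add_re, Complex.ofReal_re, Complex.re_ofReal_mul, Complex.I_re, mul_zero,
    add_zero]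

/-- Deforming the contour from the real line to the descent path. Both integrals are limits of
increments of one primitive, and the increments differ by a vanishing amount. -/
lemma integral_cubicGaussian {s : ℝ} (hs : 0 < s) :
    ∫ x : ℝ, cubicGaussian s x =
      ((Real.exp (1 / (108 * s ^ 2)) * (1 / (3 * s) * (1 / √3)) *
        besselK (1 / 3) (1 / (108 * s ^ 2)) : ℝ) : ℂ) := by
  have hz : 0 < 1 / (108 * s ^ 2) := by positivity
  obtain ⟨F, hF⟩ := (differentiable_cubicGaussian s).isExactOn_univ
  replace hF : ∀ w, HasDerivAt F (cubicGaussian s w) w := fun w => hF w trivial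
  set X : ℝ → ℝ := fun v => 1 / (3 * s) * (√3 / 2) * Real.sinh v with hX
  set Y' : ℝ → ℂ := fun v => ((1 / (3 * s) * (√3 / 2) * Real.cosh v : ℝ) : ℂ) +
        ((1 / (3 * s) * (1 / 2) * Real.sinh v : ℝ) : ℂ) * Complex.I with hY'
  have hsinh : Tendsto Real.sinh atTop atTop :=
    tendsto_atTop_mono' _ ((eventually_ge_atTop 0).mono fun v hv =>
      Real.self_le_sinh_iff.2 hv) tendsto_id
  have hXtop : Tendsto X atTop atTop := hsinh.const_mul_atTop (by positivity)
  have hXneg (v : ℝ) : X (-v) = -X v := by simp [hX, Real.sinh_neg]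
  have hcont := (differentiable_cubicGaussian s).continuous
  -- The increment along the real line.
  have hreal : Tendsto (fun v => F (X v) - F ((X (-v) : ℝ) : ℂ)) atTop
      (𝓝 (∫ x : ℝ, cubicGaussian s x)) := by
    refine (intervalIntegral_tendsto_integral (integrable_cubicGaussian s)
      (tendsto_neg_atTop_atBot.comp hXtop) hXtop).congr fun v => ?_
    rw [hXneg]
    refine intervalIntegral.integral_eq_sub_of_hasDerivAt (f := fun x : ℝ => F x) (fun x _ => ?_)
      ((hcont.comp Complex.continuous_ofReal).intervalIntegrable _ _)
    exact (hF x).comp_ofReal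
  -- The increment along the descent path.
  have hint1 : Integrable fun v : ℝ =>
      ((Real.exp (1 / (108 * s ^ 2)) * (1 / (3 * s) * (√3 / 2)) : ℝ) : ℂ) *
        ((Real.exp (-(1 / (108 * s ^ 2)) * Real.cosh (3 * v)) * Real.cosh v : ℝ) : ℂ) :=
    ((integrable_exp_neg_cosh_mul_cosh hz).ofReal (𝕜 := ℂ)).const_mul _
  have hint2 : Integrable fun v : ℝ =>
      ((Real.exp (1 / (108 * s ^ 2)) * (1 / (3 * s) * (1 / 2)) : ℝ) * Complex.I) *
        ((Real.exp (-(1 / (108 * s ^ 2)) * Real.cosh (3 * v)) * Real.sinh v : ℝ) : ℂ) :=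
    ((integrable_exp_neg_cosh_mul_sinh hz).ofReal (𝕜 := ℂ)).const_mul _
  have hpath : Tendsto (fun v => F (descentPath s v) - F (descentPath s (-v))) atTop
      (𝓝 (∫ v : ℝ, cubicGaussian s (descentPath s v) * Y' v)) := by
    have hint : Integrable fun v : ℝ => cubicGaussian s (descentPath s v) * Y' v :=
      (hint1.add hint2).congr
        (ae_of_all _ fun v => (cubicGaussian_descentPath_mul_deriv hs v).symm)
    refine (intervalIntegral_tendsto_integral hint tendsto_neg_atTop_atBot
      tendsto_id).congr fun v => ?_
    refine intervalIntegral.integral_eq_sub_of_hasDerivAt (f := fun v => F (descentPath s v))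
      (fun x _ => ?_) hint.intervalIntegrable
    exact (hF _).comp x (hasDerivAt_descentPath s x)
  -- The two increments differ by a vanishing amount.
  have hbound (v : ℝ) : ‖F (descentPath s v) - F (X v)‖ ≤ |X v| * Real.exp (-X v ^ 2 / 3) := by
    refine norm_primitive_sub_le hs hF ?_ ?_
    · have := Real.one_le_cosh v
      have : 0 ≤ Real.cosh v - 1 := by linarith
      positivity
    · have h1 := Real.one_le_cosh v
      have h3 := Real.sq_sqrt (show (0 : ℝ) ≤ 3 by norm_num)
      simp only [mul_pow, div_pow, h3, Real.sinh_sq]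
      have : 0 < (1 / (3 * s)) ^ 2 := by positivity
      field_simp
      nlinarith
  have hdecay : Tendsto (fun x : ℝ => |x| * Real.exp (-x ^ 2 / 3)) atTop (𝓝 0) := by
    have h := (rpow_mul_exp_neg_mul_sq_isLittleO_exp_neg (b := 1 / 3) (by norm_num) 1)
    have h' := h.trans_tendsto (Real.tendsto_exp_atBot.comp
      ((tendsto_id).const_mul_atTop_of_neg (show -(1 / 2 : ℝ) < 0 by norm_num)))
    refine h'.congr' ((eventually_ge_atTop 0).mono fun x hx => ?_)
    simp only [Real.rpow_one, abs_of_nonneg hx]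
    congr 2
    ring
  have hgap : Tendsto (fun v => (F (descentPath s v) - F (descentPath s (-v))) -
      (F (X v) - F ((X (-v) : ℝ) : ℂ))) atTop (𝓝 0) := by
    refine squeeze_zero_norm (a := fun v => 2 * (|X v| * Real.exp (-X v ^ 2 / 3))) (fun v => ?_) ?_
    · have h1 := hbound v
      have h2 := hbound (-v)
      rw [hXneg, abs_neg, neg_sq] at h2
      rw [hXneg]
      have h3 := norm_sub_le (F (descentPath s v) - F (X v))
        (F (descentPath s (-v)) - F ((-X v : ℝ) : ℂ))
      rw [sub_sub_sub_comm]
      linarith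
    · simpa using (hdecay.comp hXtop).const_mul 2
  have hlim := sub_eq_zero.1 (tendsto_nhds_unique (hpath.sub hreal) hgap)
  rw [← hlim, hY']
  simp only [cubicGaussian_descentPath_mul_deriv hs]
  refine (integral_add hint1 hint2).trans ?_
  rw [integral_const_mul, integral_const_mul, integral_complex_ofReal,
    integral_complex_ofReal, integral_exp_neg_cosh_mul_sinh, integral_exp_neg_cosh_mul_cosh]
  have h3 : (1 / √3) = √3 / 3 := by
    rw [div_eq_div_iff (by positivity) (by norm_num)]
    norm_num
  rw [h3]
  generalize besselK (1 / 3) (1 / (108 * s ^ 2)) = B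
  push_cast
  ring

/-! ### Multiplication operators and their unitary groups -/

/-- `A` is the maximal operator of multiplication by the real function `m` on `L²(ℝ, ℂ)`: its graph
consists of all pairs of square integrable functions `f` and `m f`. -/
def IsMultiplicationBy (A : HilbL2 →ₗ.[ℂ] HilbL2) (m : ℝ → ℝ) : Prop :=
  ∀ f g : HilbL2, (f, g) ∈ A.graph ↔ g =ᵐ[volume] fun x => (m x : ℂ) * f x

/-- Dominated convergence in `L²`, for functions known up to null sets. -/
lemma tendsto_hilbL2_of_dominated {ι : Type*} {l : Filter ι} [l.IsCountablyGenerated]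
    {f : ι → HilbL2} {F : HilbL2} {φ : ι → ℝ → ℂ} {ψ : ℝ → ℂ} {g : ℝ → ℂ}
    (hf : ∀ i, f i =ᵐ[volume] φ i) (hF : F =ᵐ[volume] ψ) (hg : MemLp g 2 volume)
    (hbound : ∀ᶠ i in l, ∀ᵐ x, ‖φ i x - ψ x‖ ≤ ‖g x‖)
    (hlim : ∀ᵐ x, Tendsto (fun i => φ i x) l (𝓝 (ψ x))) : Tendsto f l (𝓝 F) := by
  rw [Lp.tendsto_Lp_iff_tendsto_eLpNorm']
  have h1 (i : ι) : eLpNorm (⇑(f i) - ⇑F) 2 volume =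
      (∫⁻ x, ‖φ i x - ψ x‖ₑ ^ (2 : ℝ)) ^ (1 / 2 : ℝ) := by
    rw [eLpNorm_congr_ae ((hf i).sub hF),
      eLpNorm_eq_lintegral_rpow_enorm_toReal (by simp) (by simp)]
    simp
  simp only [h1]
  have h2 : Tendsto (fun i => ∫⁻ x, ‖φ i x - ψ x‖ₑ ^ (2 : ℝ)) l (𝓝 (∫⁻ _ : ℝ, 0)) := by
    refine tendsto_lintegral_filter_of_dominated_convergence' (fun x => ‖g x‖ₑ ^ (2 : ℝ))
      (Eventually.of_forall fun i => ?_) ?_ ?_ ?_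
    · have hφ : AEStronglyMeasurable (φ i) volume :=
        (Lp.aestronglyMeasurable (f i)).congr (hf i)
      have hψ : AEStronglyMeasurable ψ volume := (Lp.aestronglyMeasurable F).congr hF
      exact (hφ.sub hψ).enorm.pow_const _
    · filter_upwards [hbound] with i hi
      filter_upwards [hi] with x hx
      gcongr
      exact enorm_le_iff_norm_le.2 hx
    · have := lintegral_rpow_enorm_lt_top_of_eLpNorm_lt_top (p := 2) (by simp) (by simp)
        hg.eLpNorm_lt_top
      simpa using this.ne
    · filter_upwards [hlim] with x hx
      have h3 := (((hx.sub_const (ψ x)).enorm).ennrpow_const 2)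
      simpa using h3
  have h4 := h2.ennrpow_const (1 / 2)
  simpa using h4

section PhaseMultiplication

lemma norm_exp_I_mul_mul (t m : ℝ) : ‖Complex.exp (Complex.I * t * m)‖ = 1 := by
  rw [Complex.norm_exp]
  simp

lemma measurable_exp_I_mul_mul {m : ℝ → ℝ} (hm : Measurable m) (t : ℝ) :
    Measurable fun x => Complex.exp (Complex.I * t * m x) := by
  fun_prop

lemma memLp_phase_mul {m : ℝ → ℝ} (hm : Measurable m) (t : ℝ) (f : HilbL2) :
    MemLp (fun x => Complex.exp (Complex.I * t * m x) * f x) 2 volume := by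
  refine (Lp.memLp f).of_le ((measurable_exp_I_mul_mul hm t).aestronglyMeasurable.mul
    (Lp.aestronglyMeasurable f)) (ae_of_all _ fun x => ?_)
  rw [norm_mul, norm_exp_I_mul_mul, one_mul]

/-- Multiplication by the unimodular function `exp (i t m)`, as a linear isometry of
`L²(ℝ, ℂ)`. -/
noncomputable def phaseMul {m : ℝ → ℝ} (hm : Measurable m) (t : ℝ) : HilbL2 →ₗᵢ[ℂ] HilbL2 where
  toFun f := (memLp_phase_mul hm t f).toLp _
  map_add' f g := by
    rw [← MemLp.toLp_add]
    refine MemLp.toLp_congr _ _ ?_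
    filter_upwards [Lp.coeFn_add f g] with x hx
    simp only [hx, Pi.add_apply, mul_add]
  map_smul' c f := by
    rw [RingHom.id_apply, ← MemLp.toLp_const_smul]
    refine MemLp.toLp_congr _ _ ?_
    filter_upwards [Lp.coeFn_smul c f] with x hx
    simp only [hx, Pi.smul_apply, smul_eq_mul, mul_left_comm]
  norm_map' f := by
    simp only [LinearMap.coe_mk, AddHom.coe_mk, Lp.norm_def]
    congr 1
    refine eLpNorm_congr_norm_ae ?_
    filter_upwards [(memLp_phase_mul hm t f).coeFn_toLp] with x hx
    rw [hx, norm_mul, norm_exp_I_mul_mul, one_mul]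

variable {m : ℝ → ℝ} (hm : Measurable m)

lemma coeFn_phaseMul (t : ℝ) (f : HilbL2) :
    phaseMul hm t f =ᵐ[volume] fun x => Complex.exp (Complex.I * t * m x) * f x :=
  (memLp_phase_mul hm t f).coeFn_toLp

lemma phaseMul_add (s t : ℝ) (f : HilbL2) :
    phaseMul hm (s + t) f = phaseMul hm s (phaseMul hm t f) := by
  apply Lp.ext
  filter_upwards [coeFn_phaseMul hm (s + t) f, coeFn_phaseMul hm t f,
    coeFn_phaseMul hm s (phaseMul hm t f)] with x h1 h2 h3
  rw [h1, h3, h2, ← mul_assoc, ← Complex.exp_add]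
  congr 2
  push_cast
  ring

lemma phaseMul_zero (f : HilbL2) : phaseMul hm 0 f = f := by
  apply Lp.ext
  filter_upwards [coeFn_phaseMul hm 0 f] with x h1
  simp [h1]

lemma phaseMul_mem_unitary (t : ℝ) :
    (phaseMul hm t).toContinuousLinearMap ∈ unitary (HilbL2 →L[ℂ] HilbL2) := by
  have hinv (s : ℝ) : (phaseMul hm s).toContinuousLinearMap *
      (phaseMul hm (-s)).toContinuousLinearMap = 1 := by
    ext1 f
    simp [← phaseMul_add, phaseMul_zero]
  refine IsUnit.mem_unitary_of_star_mul_self ⟨⟨_, _, hinv t, ?_⟩, rfl⟩ <|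
    (ContinuousLinearMap.norm_map_iff_adjoint_comp_self _).1 (phaseMul hm t).norm_map
  simpa using hinv (-t)

lemma continuous_phaseMul (f : HilbL2) : Continuous fun t => phaseMul hm t f := by
  refine continuous_iff_continuousAt.2 fun s => ?_
  refine tendsto_hilbL2_of_dominated (fun t => coeFn_phaseMul hm t f) (coeFn_phaseMul hm s f)
    ((Lp.memLp f).const_mul 2) (Eventually.of_forall fun t => ae_of_all _ fun x => ?_)
    (ae_of_all _ fun x => ?_)
  · refine (norm_sub_le _ _).trans ?_
    simp only [norm_mul, norm_exp_I_mul_mul, RCLike.norm_ofNat]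
    linarith
  · have : Continuous fun t : ℝ => Complex.exp (Complex.I * t * m x) * f x := by fun_prop
    exact this.tendsto s

lemma hasDerivAt_exp_I_mul_mul (a : ℝ) :
    HasDerivAt (fun t : ℝ => Complex.exp (Complex.I * t * a)) (Complex.I * a) 0 := by
  have h : HasDerivAt (fun t : ℝ => Complex.I * t * a) (Complex.I * a) 0 := by
    simpa using ((hasDerivAt_id (0 : ℝ)).ofReal_comp.const_mul Complex.I).mul_const (a : ℂ)
  simpa using h.cexp

lemma tendsto_phase_slope (a : ℝ) (w : ℂ) :
    Tendsto (fun t : ℝ => (t : ℂ)⁻¹ * ((Complex.exp (Complex.I * t * a) - 1) * w)) (𝓝[≠] 0)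
      (𝓝 (Complex.I * (a * w))) := by
  have h := ((hasDerivAt_exp_I_mul_mul a).tendsto_slope_zero).mul_const w
  refine (h.congr fun t => ?_).trans_eq ?_
  · simp [mul_assoc]
  · rw [mul_assoc]

lemma norm_phase_slope_le (a t : ℝ) :
    ‖(t : ℂ)⁻¹ * (Complex.exp (Complex.I * t * a) - 1)‖ ≤ |a| := by
  rcases eq_or_ne t 0 with rfl | ht
  · simp
  have h := Real.norm_exp_I_mul_ofReal_sub_one_le (x := t * a)
  rw [norm_mul, norm_inv, Complex.norm_real, Real.norm_eq_abs, inv_mul_le_iff₀ (abs_pos.2 ht),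
    ← abs_mul]
  simpa [mul_assoc] using h

lemma coeFn_phaseMul_slope (f : HilbL2) (t : ℝ) :
    (t⁻¹ • (phaseMul hm (0 + t) f - phaseMul hm 0 f) : HilbL2) =ᵐ[volume]
      fun x => (t : ℂ)⁻¹ * ((Complex.exp (Complex.I * t * m x) - 1) * f x) := by
  rw [zero_add, phaseMul_zero]
  filter_upwards [Lp.coeFn_smul t⁻¹ (phaseMul hm t f - f), Lp.coeFn_sub (phaseMul hm t f) f,
    coeFn_phaseMul hm t f] with x h1 h2 h3
  rw [h1, Pi.smul_apply, h2, Pi.sub_apply, h3, Complex.real_smul]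
  push_cast
  ring

/-- The strong derivative of the phase group at `0` is multiplication by `i m`, on the maximal
domain. In one direction the difference quotients are dominated by `|m f|`; in the other, a
sequence of difference quotients converges almost everywhere, to `i m f`. -/
lemma hasDerivAt_phaseMul_iff (f g : HilbL2) :
    HasDerivAt (fun t => phaseMul hm t f) (Complex.I • g) 0 ↔
      g =ᵐ[volume] fun x => (m x : ℂ) * f x := by
  rw [hasDerivAt_iff_tendsto_slope_zero]
  constructor
  · intro h
    have hu : Tendsto (fun n : ℕ => 1 / ((n : ℝ) + 1)) atTop (𝓝[≠] 0) :=
      tendsto_nhdsWithin_iff.2 ⟨tendsto_one_div_add_atTop_nhds_zero_nat,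
        Eventually.of_forall fun n => (Nat.one_div_pos_of_nat (α := ℝ)).ne'⟩
    obtain ⟨ns, hns, hae⟩ := (tendstoInMeasure_of_tendsto_Lp (h.comp hu)).exists_seq_tendsto_ae
    filter_upwards [hae, Lp.coeFn_smul Complex.I g,
      ae_all_iff.2 fun n : ℕ => coeFn_phaseMul_slope hm f (1 / ((n : ℝ) + 1))] with x h1 h2 h3
    have h4 := (tendsto_phase_slope (m x) (f x)).comp (hu.comp hns.tendsto_atTop)
    have h5 := tendsto_nhds_unique h1 (h4.congr fun n => (h3 (ns n)).symm)
    rw [h2, Pi.smul_apply, smul_eq_mul] at h5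
    exact mul_left_cancel₀ Complex.I_ne_zero h5
  · intro h
    have hlim : (Complex.I • g : HilbL2) =ᵐ[volume] fun x => Complex.I * (m x * f x) := by
      filter_upwards [h, Lp.coeFn_smul Complex.I g] with x h1 h2
      rw [h2, Pi.smul_apply, smul_eq_mul, h1]
    refine tendsto_hilbL2_of_dominated (coeFn_phaseMul_slope hm f) hlim
      ((Lp.memLp g).const_mul 2) (Eventually.of_forall fun t => ?_)
      (ae_of_all _ fun x => tendsto_phase_slope (m x) (f x))
    filter_upwards [h] with x hx
    refine (norm_sub_le _ _).trans ?_
    rw [← mul_assoc, norm_mul _ (f x), hx]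
    have := mul_le_mul_of_nonneg_right (norm_phase_slope_le (m x) t) (norm_nonneg (f x))
    simp only [norm_mul, Complex.norm_I, Complex.norm_real, Real.norm_eq_abs, RCLike.norm_ofNat]
      at this ⊢
    linarith

lemma isUnitaryGroupOf_phaseMul {A : HilbL2 →ₗ.[ℂ] HilbL2} (hA : IsMultiplicationBy A m) :
    IsUnitaryGroupOf A fun t => (phaseMul hm t).toContinuousLinearMap where
  unitary := phaseMul_mem_unitary hm
  map_add s t := by
    ext1 f
    exact phaseMul_add hm s t f
  continuous := continuous_phaseMul hm
  generator f g := (hA f g).trans (hasDerivAt_phaseMul_iff hm f g).symm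

end PhaseMultiplication

lemma IsMultiplicationBy.mem_domain {A : HilbL2 →ₗ.[ℂ] HilbL2} {m : ℝ → ℝ}
    (hA : IsMultiplicationBy A m) {f : HilbL2} (hf : MemLp (fun x => (m x : ℂ) * f x) 2 volume) :
    f ∈ A.domain :=
  LinearPMap.mem_domain_of_mem_graph ((hA f (hf.toLp _)).2 hf.coeFn_toLp)

/-- A function is the `L²` limit of its truncations to the sets `{|m| ≤ n}`. -/
lemma IsMultiplicationBy.dense_domain {A : HilbL2 →ₗ.[ℂ] HilbL2} {m : ℝ → ℝ}
    (hA : IsMultiplicationBy A m) (hm : Measurable m) : Dense (A.domain : Set HilbL2) := by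
  intro f
  have hs (n : ℕ) : MeasurableSet {x | |m x| ≤ n} := measurableSet_le (by fun_prop) (by fun_prop)
  have hf (n : ℕ) : MemLp ({x | |m x| ≤ n}.indicator f) 2 volume := (Lp.memLp f).indicator (hs n)
  refine mem_closure_of_tendsto (f := fun n : ℕ => (hf n).toLp _) (b := atTop) ?_
    (Eventually.of_forall fun n => hA.mem_domain ?_)
  · refine tendsto_hilbL2_of_dominated (fun n => (hf n).coeFn_toLp) (EventuallyEq.refl _ _)
      (Lp.memLp f) (Eventually.of_forall fun n => ae_of_all _ fun x => ?_)
      (ae_of_all _ fun x => ?_)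
    · by_cases hx : x ∈ {x | |m x| ≤ n}
      · simp [Set.indicator_of_mem hx]
      · simp [Set.indicator_of_notMem hx]
    · obtain ⟨N, hN⟩ := exists_nat_ge |m x|
      refine tendsto_const_nhds.congr' ((eventually_ge_atTop N).mono fun n hn => ?_)
      have hx : x ∈ {x | |m x| ≤ n} := hN.trans (by exact_mod_cast hn)
      exact (Set.indicator_of_mem hx f).symm
  · refine ((Lp.memLp f).const_mul (n : ℂ)).of_le
      ((Complex.measurable_ofReal.comp hm).aestronglyMeasurable.mul
        (Lp.aestronglyMeasurable _)) ?_
    filter_upwards [(hf n).coeFn_toLp] with x hx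
    rw [hx]
    by_cases h : x ∈ {x | |m x| ≤ n}
    · rw [Set.indicator_of_mem h, norm_mul, norm_mul, Complex.norm_real, Complex.norm_natCast]
      exact mul_le_mul_of_nonneg_right h (norm_nonneg _)
    · rw [Set.indicator_of_notMem h, mul_zero, norm_zero]
      exact norm_nonneg _

namespace IsUnitaryGroupOf

variable {A : HilbL2 →ₗ.[ℂ] HilbL2} {U V : ℝ → HilbL2 →L[ℂ] HilbL2}

lemma norm_map (hU : IsUnitaryGroupOf A U) (t : ℝ) (f : HilbL2) : ‖U t f‖ = ‖f‖ :=
  ContinuousLinearMap.norm_map_of_mem_unitary (hU.unitary t) f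

lemma add_apply (hU : IsUnitaryGroupOf A U) (s t : ℝ) (f : HilbL2) :
    U (s + t) f = U s (U t f) := by
  rw [hU.map_add, mul_apply_eq_comp]

lemma zero_apply (hU : IsUnitaryGroupOf A U) (f : HilbL2) : U 0 f = f := by
  have h := hU.add_apply 0 0 f
  rw [add_zero] at h
  have h2 := hU.norm_map 0 (U 0 f - f)
  rw [map_sub, ← h, sub_self, norm_zero] at h2
  exact sub_eq_zero.1 (norm_eq_zero.1 h2.symm)

/-- The group preserves the domain of its generator and commutes with it. -/
lemma map_mem_graph (hU : IsUnitaryGroupOf A U) {f g : HilbL2} (h : (f, g) ∈ A.graph) (t : ℝ) :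
    (U t f, U t g) ∈ A.graph := by
  rw [hU.generator] at h ⊢
  have h1 := ((U t).restrictScalars ℝ).hasFDerivAt.comp_hasDerivAt (0 : ℝ) h
  rw [← map_smul]
  refine h1.congr_of_eventuallyEq (Eventually.of_forall fun s => ?_)
  change U s (U t f) = U t (U s f)
  rw [← hU.add_apply, ← hU.add_apply, add_comm]

lemma hasDerivAt (hU : IsUnitaryGroupOf A U) {f g : HilbL2} (h : (f, g) ∈ A.graph) (t : ℝ) :
    HasDerivAt (fun s => U s f) (Complex.I • U t g) t := by
  have h1 := (hU.generator _ _).1 (hU.map_mem_graph h t)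
  rw [← sub_self t] at h1
  refine (h1.comp_sub_const t t).congr_of_eventuallyEq (Eventually.of_forall fun s => ?_)
  change U s f = U (s - t) (U t f)
  rw [← hU.add_apply, sub_add_cancel]

/-- Infinitesimal unitarity: the generator is skew for the real inner product. -/
lemma inner_I_smul_eq_zero (hU : IsUnitaryGroupOf A U) {f g : HilbL2} (h : (f, g) ∈ A.graph) :
    inner ℝ f (Complex.I • g) = 0 := by
  have h1 := (hU.hasDerivAt h 0).norm_sq
  simp only [hU.norm_map, hU.zero_apply] at h1
  have h2 := h1.unique (hasDerivAt_const (0 : ℝ) (‖f‖ ^ 2))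
  linarith

/-- A unitary group is determined by its generator: for `f` in the domain, `‖V t f - U t f‖²` has
zero derivative by `inner_I_smul_eq_zero`, and it vanishes at `t = 0`. -/
lemma unique (hU : IsUnitaryGroupOf A U) (hV : IsUnitaryGroupOf A V)
    (hA : Dense (A.domain : Set HilbL2)) : V = U := by
  funext t
  refine DFunLike.coe_injective (Continuous.ext_on hA (V t).continuous (U t).continuous ?_)
  intro f hf
  have hfg := A.mem_graph ⟨f, hf⟩
  set g := A ⟨f, hf⟩
  have hd (s : ℝ) : HasDerivAt (fun s => ‖V s f - U s f‖ ^ 2) 0 s := by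
    have h1 := ((hV.hasDerivAt hfg s).sub (hU.hasDerivAt hfg s)).norm_sq
    have h2 := hU.inner_I_smul_eq_zero
      (A.graph.sub_mem (hV.map_mem_graph hfg s) (hU.map_mem_graph hfg s))
    rw [smul_sub] at h2
    simpa [h2] using h1
  have h3 := is_const_of_deriv_eq_zero (fun s => (hd s).differentiableAt)
    (fun s => (hd s).deriv) t 0
  simp only [hU.zero_apply, hV.zero_apply, sub_self, norm_zero] at h3
  simpa [sub_eq_zero] using h3

end IsUnitaryGroupOf

/-- The characteristic function, in the state `Φ`, of a multiplication operator. -/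
lemma IsMultiplicationBy.hasQuantumCharFun {A : HilbL2 →ₗ.[ℂ] HilbL2} {m : ℝ → ℝ}
    (hA : IsMultiplicationBy A m) (hm : Measurable m) :
    HasQuantumCharFun A fun t => inner ℂ gaussianState (phaseMul hm t gaussianState) :=
  ⟨_, isUnitaryGroupOf_phaseMul hm hA, fun _ hV =>
    (isUnitaryGroupOf_phaseMul hm hA).unique hV (hA.dense_domain hm), fun _ => rfl⟩

/-! ### The operator `S` and its cube -/

lemma isMultiplicationBy_positionOp : IsMultiplicationBy positionOp fun x => x := by
  intro f g
  rw [LinearPMap.mem_graph_iff]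
  constructor
  · rintro ⟨y, rfl, rfl⟩
    exact MemLp.coeFn_toLp y.2
  · intro h
    have hf : f ∈ positionOp.domain := (memLp_congr_ae h).1 (Lp.memLp g)
    refine ⟨⟨f, hf⟩, rfl, Lp.ext ?_⟩
    exact (MemLp.coeFn_toLp hf).trans h.symm

lemma IsMultiplicationBy.smul {A : HilbL2 →ₗ.[ℂ] HilbL2} {m : ℝ → ℝ}
    (hA : IsMultiplicationBy A m) {c : ℝ} (hc : c ≠ 0) :
    IsMultiplicationBy ((c : ℂ) • A) fun x => c * m x := by
  intro f g
  have hc' : (c : ℂ) ≠ 0 := by exact_mod_cast hc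
  have h1 : (f, g) ∈ ((c : ℂ) • A).graph ↔ (f, (c : ℂ)⁻¹ • g) ∈ A.graph := by
    simp only [LinearPMap.mem_graph_iff, LinearPMap.smul_apply]
    refine exists_congr fun y => and_congr_right fun _ => ?_
    exact eq_inv_smul_iff₀ hc' |>.symm
  rw [h1, hA f]
  refine eventually_congr ?_
  filter_upwards [Lp.coeFn_smul (c : ℂ)⁻¹ g] with x hx
  rw [hx, Pi.smul_apply, smul_eq_mul, inv_mul_eq_iff_eq_mul₀ hc']
  push_cast
  rw [mul_assoc]

lemma mem_graph_unboundedComp {B A : HilbL2 →ₗ.[ℂ] HilbL2} {f g : HilbL2} :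
    (f, g) ∈ (unboundedComp B A).graph ↔ ∃ h, (f, h) ∈ A.graph ∧ (h, g) ∈ B.graph := by
  simp only [LinearPMap.mem_graph_iff]
  constructor
  · rintro ⟨⟨y, hy, hy'⟩, rfl, rfl⟩
    exact ⟨A ⟨y, hy⟩, ⟨⟨y, hy⟩, rfl, rfl⟩, ⟨⟨_, hy'⟩, rfl, rfl⟩⟩
  · rintro ⟨h, ⟨⟨y, hy⟩, rfl, rfl⟩, ⟨⟨z, hz⟩, hz', rfl⟩⟩
    obtain rfl : z = A ⟨y, hy⟩ := hz'
    exact ⟨⟨y, hy, hz⟩, rfl, rfl⟩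

/-- The natural domain of the cube of a multiplication operator is maximal, since `|m|` and `m²`
are bounded by `1 + |m|³`. -/
lemma IsMultiplicationBy.cube {A : HilbL2 →ₗ.[ℂ] HilbL2} {m : ℝ → ℝ}
    (hA : IsMultiplicationBy A m) (hm : Measurable m) :
    IsMultiplicationBy (unboundedCube A) fun x => m x ^ 3 := by
  intro f g
  simp only [unboundedCube, mem_graph_unboundedComp]
  constructor
  · rintro ⟨h2, ⟨h1, hf, h12⟩, h2g⟩
    filter_upwards [(hA _ _).1 hf, (hA _ _).1 h12, (hA _ _).1 h2g] with x e1 e2 e3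
    rw [e3, e2, e1]
    push_cast
    ring
  · intro h
    have hmem (k : ℕ) (hk : k ≤ 3) : MemLp (fun x => ((m x ^ k : ℝ) : ℂ) * f x) 2 volume := by
      refine ((Lp.memLp f).norm.add (Lp.memLp g).norm).of_le
        (AEStronglyMeasurable.mul (by fun_prop) (Lp.aestronglyMeasurable f)) ?_
      filter_upwards [h] with x hx
      have h0 := norm_nonneg (f x)
      rw [Pi.add_apply, hx, Real.norm_of_nonneg (by positivity), norm_mul, norm_mul,
        Complex.norm_real, Complex.norm_real, norm_pow, norm_pow]
      have h1 : ‖m x‖ ^ k ≤ 1 + ‖m x‖ ^ 3 := by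
        rcases le_total ‖m x‖ 1 with h | h
        · have := pow_le_one₀ (n := k) (norm_nonneg (m x)) h
          have : 0 ≤ ‖m x‖ ^ 3 := by positivity
          linarith
        · have := pow_le_pow_right₀ h hk
          linarith
      nlinarith [mul_le_mul_of_nonneg_right h1 h0]
    have c1 := (hmem 1 (by norm_num)).coeFn_toLp
    have c2 := (hmem 2 (by norm_num)).coeFn_toLp
    refine ⟨(hmem 2 (by norm_num)).toLp _, ⟨(hmem 1 (by norm_num)).toLp _, (hA _ _).2 ?_,
      (hA _ _).2 ?_⟩, (hA _ _).2 ?_⟩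
    · filter_upwards [c1] with x e1
      rw [e1, pow_one]
    · filter_upwards [c1, c2] with x e1 e2
      rw [e1, e2]
      push_cast
      ring
    · filter_upwards [c2, h] with x e2 e3
      rw [e2, e3]
      push_cast
      ring

lemma isMultiplicationBy_opS {σ : ℝ} (hσ : σ ≠ 0) :
    IsMultiplicationBy (opS σ) fun x => σ * (√2 * x) :=
  (isMultiplicationBy_positionOp.smul (by positivity)).smul hσ

/-! ### Characteristic functions -/

/-- In the state `Φ` the position is distributed as `N(0, 1/2)`. -/
lemma inner_gaussianState_phaseMul {m : ℝ → ℝ} (hm : Measurable m) (t : ℝ) :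
    inner ℂ gaussianState (phaseMul hm t gaussianState) =
      charFun ((gaussianReal 0 (1 / 2)).map m) t := by
  rw [charFun_apply_real, integral_map hm.aemeasurable (by fun_prop),
    integral_gaussianReal_eq_integral_smul (by norm_num), L2.inner_def]
  refine integral_congr_ae ?_
  filter_upwards [coeFn_phaseMul hm t gaussianState, memLp_gaussian.coeFn_toLp] with x h1 h2
  rw [h1, gaussianState, h2, RCLike.inner_apply, Complex.conj_ofReal, Complex.real_smul]
  have h3 : (Real.pi ^ (-1 / 4 : ℝ) * Real.exp (-x ^ 2 / 2)) ^ 2 =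
      gaussianPDFReal 0 (1 / 2) x := by
    rw [gaussianPDFReal, mul_pow, ← Real.exp_nat_mul, ← Real.rpow_mul_natCast Real.pi_pos.le,
      Real.sqrt_eq_rpow, ← Real.rpow_neg (by positivity)]
    push_cast
    congr 2 <;> ring_nf
  rw [← h3, mul_assoc]
  push_cast
  ring_nf

lemma integral_cubicGaussian_neg (s : ℝ) :
    ∫ x : ℝ, cubicGaussian (-s) x = ∫ x : ℝ, cubicGaussian s x := by
  rw [← integral_neg_eq_self]
  congr 1 with x
  simp only [cubicGaussian]
  congr 1
  push_cast
  ring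

lemma cubeCharFun_neg (σ t : ℝ) : cubeCharFun σ (-t) = cubeCharFun σ t := by
  simp [cubeCharFun]

/-- The law of the cube of a centred Gaussian variable. -/
lemma charFun_map_cube_gaussianReal {σ : ℝ} (hσ : 0 < σ) (t : ℝ) :
    charFun ((gaussianReal 0 (.mk (σ ^ 2) (sq_nonneg σ))).map (fun x => x ^ 3)) t =
      (cubeCharFun σ t : ℂ) := by
  have hint (t : ℝ) :
      charFun ((gaussianReal 0 (.mk (σ ^ 2) (sq_nonneg σ))).map (fun x => x ^ 3)) t =
      ((√(2 * Real.pi))⁻¹ : ℝ) * ∫ x : ℝ, cubicGaussian (t * σ ^ 3) x := by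
    have h := gaussianReal_map_const_mul (μ := 0) (v := 1) σ
    rw [mul_zero, mul_one] at h
    rw [← h, Measure.map_map (by fun_prop) (by fun_prop), charFun_apply_real,
      integral_map (by fun_prop) (by fun_prop),
      integral_gaussianReal_eq_integral_smul one_ne_zero, ← integral_const_mul]
    congr 1 with x
    rw [gaussianPDFReal, cubicGaussian, Complex.real_smul]
    push_cast
    rw [mul_assoc, ← Complex.exp_add]
    simp only [Function.comp_apply]
    push_cast
    ring_nf
  have hpos (t : ℝ) (ht : 0 < t) :
      charFun ((gaussianReal 0 (.mk (σ ^ 2) (sq_nonneg σ))).map (fun x => x ^ 3)) t =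
        (cubeCharFun σ t : ℂ) := by
    have hz : 108 * (t * σ ^ 3) ^ 2 = 108 * σ ^ 6 * t ^ 2 := by ring
    rw [hint, integral_cubicGaussian (by positivity), ← Complex.ofReal_mul, cubeCharFun,
      if_neg ht.ne', abs_of_pos ht, hz]
    have h6 : √(6 * Real.pi) = √3 * √(2 * Real.pi) := by
      rw [← Real.sqrt_mul (by norm_num)]
      congr 1
      ring
    rw [h6]
    congr 1
    field_simp
  rcases lt_trichotomy t 0 with ht | rfl | ht
  · rw [← cubeCharFun_neg, ← hpos (-t) (by linarith), hint, hint, neg_mul,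
      integral_cubicGaussian_neg]
  · have : IsProbabilityMeasure
        ((gaussianReal 0 (.mk (σ ^ 2) (sq_nonneg σ))).map (fun x => x ^ 3)) :=
      Measure.isProbabilityMeasure_map (by fun_prop)
    simp [cubeCharFun]
  · exact hpos t ht

/-- `σ √2` times an `N(0, 1/2)` variable is distributed as `N(0, σ²)`. -/
lemma map_gaussianReal_one_half (σ : ℝ) :
    (gaussianReal 0 (1 / 2)).map (fun x => σ * (√2 * x)) =
      gaussianReal 0 (.mk (σ ^ 2) (sq_nonneg σ)) := by
  have h := gaussianReal_map_const_mul (μ := 0) (v := 1 / 2) (σ * √2)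
  simp only [mul_assoc] at h
  rw [h, mul_zero, mul_zero]
  congr 1
  apply NNReal.eq
  simp [mul_pow]

theorem corollary2p5 (σ : ℝ) (hσ : 0 < σ) :
    HasQuantumCharFun (opS σ) (charFun (gaussianReal 0 ⟨σ ^ 2, sq_nonneg σ⟩)) ∧
    HasQuantumCharFun (unboundedCube (opS σ)) (fun t => (cubeCharFun σ t : ℂ)) ∧
    ∀ (Ω : Type*) [MeasurableSpace Ω] (P : Measure Ω) (Z : Ω → ℝ),
      HasLaw Z (gaussianReal 0 ⟨σ ^ 2, sq_nonneg σ⟩) P →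
      ∀ t : ℝ, charFun (P.map (fun ω => Z ω ^ 3)) t = (cubeCharFun σ t : ℂ) := by
  have hS := isMultiplicationBy_opS hσ.ne'
  have hm : Measurable fun x : ℝ => σ * (√2 * x) := by fun_prop
  refine ⟨?_, ?_, ?_⟩
  · change HasQuantumCharFun (opS σ) (charFun (gaussianReal 0 (.mk (σ ^ 2) (sq_nonneg σ))))
    convert hS.hasQuantumCharFun hm using 2 with t
    rw [inner_gaussianState_phaseMul, map_gaussianReal_one_half]
  · convert (hS.cube hm).hasQuantumCharFun (by fun_prop) using 2 with t
    rw [inner_gaussianState_phaseMul, ← charFun_map_cube_gaussianReal hσ,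
      ← map_gaussianReal_one_half, Measure.map_map (by fun_prop) hm]
    rfl
  · intro Ω _ P Z hZ t
    have hmap : P.map Z = gaussianReal 0 (.mk (σ ^ 2) (sq_nonneg σ)) := hZ.map_eq
    rw [← charFun_map_cube_gaussianReal hσ, ← hmap,
      AEMeasurable.map_map_of_aemeasurable (by fun_prop) hZ.aemeasurable]
    rfl
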